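/- Let $d\in\{2,3\}$ and let $\Omega\subset\mathbb R^d$ be a bounded open set. Norms of vector and matrix fields are $\|f\|=\|\,|f|\,\|_{L^2(\Omega)}$ with $|\cdot|$ the Euclidean (Frobenius) norm, $(\nabla\mathbf w)_{ij}=\partial_j w_i$, and $\boldsymbol\varepsilon(\mathbf w)=\frac12(\nabla\mathbf w+(\nabla\mathbf w)^t)$. Here $H^1_0(\Omega)$ is the closure of $C_c^\infty(\Omega)$ in $H^1(\Omega)$. Let $\mathcal P,\mathcal K>0$ be constants of the Poincaré and Korn inequalities, i.e. $\|\mathbf w\|\le\mathcal P\|\nabla\mathbf w\|$ and $\|\nabla\mathbf w\|\le\mathcal K\|\boldsymbol\varepsilon(\mathbf w)\|$ for all $\mathbf w\in H^1_0(\Omega)^d$. *Parameters.* Let $\alpha,\nu,\varrho,\delta>0$, $E_1>0$, $E_2<0$, $E_1-d|E_2|>0$, and $\lambda_1,\lambda_2\in\mathbb R$. Put $$\gamma_1=\tfrac1{1+|\lambda_1|\delta},\quad \gamma_2=\tfrac1{1-|\lambda_1|\delta},\quad \gamma_3=E_1+dE_2,\quad \gamma_4=E_1\lambda_1+dE_2\lambda_2,$$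 $$\gamma_5=\tfrac1{\gamma_3+|\gamma_4|\delta},\quad \gamma_6=\tfrac1{\gamma_3-|\gamma_4|\delta},\quad \gamma_7=1-|\lambda_2|\delta,\quad \gamma_8=1+|\lambda_2|\delta,$$ and assume that $\lambda_1,\lambda_2$ are so small that $1-|\lambda_1|\delta>0$, $\gamma_3-|\gamma_4|\delta>0$ and $\gamma_7>0$. Let $F(f)=E_1(1+\lambda_1f)-d|E_2|(1+\lambda_2f)$, and let $T_\delta$ be the truncation $T_\delta f=f$ if $|f|\le\delta$, $T_\delta f=\delta\,\mathrm{sign}(f)$ otherwise. *Discrete scheme.* Let $\boldsymbol U_h,\boldsymbol X_h\subset H^1_0(\Omega)^d$ and $Q_h\subset L^2_0(\Omega)=\{q\in L^2(\Omega):\int_\Omega q=0\}$ be finite-dimensional subspaces, $\boldsymbol V_h=\{\mathbf v\in\boldsymbol X_h:\int_\Omega q\,\mathrm{div}\,\mathbf v=0\ \forall q\in Q_h\}$, and let $h,C>0$ and $\Pi_h:H^1_0(\Omega)^d\to\boldsymbol U_h$ satisfy $\|\nabla\Pi_h\mathbf w\|\le C\|\nabla\mathbf w\|$ and $\|\mathbf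 w-\Pi_h\mathbf w\|\le Ch\|\nabla\mathbf w\|$ for all $\mathbf w\in H^1_0(\Omega)^d$. Let $T>0$, $N\ge1$, $\Delta t=T/N$, $t_n=n\Delta t$. Let $\mathbf u_h^n\in\boldsymbol U_h$, $\mathbf v_h^n\in\boldsymbol V_h$ ($0\le n\le N$) and $p_h^n\in Q_h$ ($1\le n\le N$) satisfy, for $1\le n\le N$, for all $\mathbf z_h\in\boldsymbol U_h$, $$\frac{\alpha}{\Delta t}\int_\Omega(\mathbf u_h^n-\mathbf u_h^{n-1})\cdot\mathbf z_h+\frac1{E_1}\int_\Omega\frac{\boldsymbol\varepsilon(\mathbf u_h^n):\boldsymbol\varepsilon(\mathbf z_h)}{1+\lambda_1T_\delta\mathrm{div}\,\mathbf u_h^{n-1}}+\frac{|E_2|}{E_1}\int_\Omega\frac{1+\lambda_2T_\delta\mathrm{div}\,\mathbf u_h^{n-1}}{1+\lambda_1T_\delta\mathrm{div}\,\mathbf u_h^{n-1}}\,\frac{\mathrm{div}\,\mathbf u_h^n\,\mathrm{div}\,\mathbf z_h}{F(T_\delta\mathrm{div}\,\mathbf u_h^{n-1})}=\alpha\int_\Omega\mathbf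 v_h^n\cdot\mathbf z_h,$$ and for all $\mathbf w_h\in\boldsymbol X_h$, $$\frac{\varrho}{\Delta t}\int_\Omega(\mathbf v_h^n-\mathbf v_h^{n-1})\cdot\mathbf w_h-\int_\Omega p_h^n\,\mathrm{div}\,\mathbf w_h+\nu\int_\Omega\nabla\mathbf v_h^n:\nabla\mathbf w_h+\alpha\int_\Omega\mathbf v_h^n\cdot\mathbf w_h=\frac{\alpha}{\Delta t}\int_\Omega(\mathbf u_h^n-\mathbf u_h^{n-1})\cdot\mathbf w_h.$$ *Constants.* Put $$\mathcal D_1=\frac{(\gamma_6\gamma_8)^2}{\gamma_5\gamma_7}|E_2|,\quad \mathcal D_2=1+\frac{\mathcal D_1}2,\quad \mathcal D_3=\frac{(\alpha h)^2}{\Delta t}+\frac{\alpha}{E_1}\frac{\gamma_2^2}{\gamma_1}\mathcal D_2,\quad \mathcal D_4=(\alpha\mathcal P)^2\Big(1+\frac{E_1\mathcal K^2}{\alpha\gamma_1}\mathcal D_3\Big),$$ $$C_1=\|\mathbf v_h^0\|^2+\frac{3C^2\mathcal D_3}{\nu\varrho}\|\mathbf u_h^0\|^2,\quad C_2=\frac{9C^2\mathcal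 D_4}{\nu\varrho},\quad d_2(\mathbf f)=\|\boldsymbol\varepsilon(\mathbf f)\|^2+2|E_2|\gamma_5\gamma_7\|\mathrm{div}\,\mathbf f\|^2 .$$ **Statement.** If $6\,\dfrac{C^2\mathcal D_4}{\nu\varrho}\,\Delta t\le1$, then for all $1\le n\le N$, $$\|\mathbf u_h^n\|^2+\sum_{i=1}^n\|\mathbf u_h^i-\mathbf u_h^{i-1}\|^2+\frac{\gamma_1}{\alpha E_1}\sum_{i=1}^n\Delta t\,d_2(\mathbf u_h^i)\le\|\mathbf u_h^0\|^2+\frac{E_1}{\gamma_1}\frac{(\mathcal P\mathcal K)^2}2\,\varrho\,C_1\exp(C_2t_n).$$ -/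

import Mathlib

open MeasureTheory

namespace Poro

noncomputable section

/-! ### Lebesgue and Sobolev spaces on a domain of `ℝ^d` -/

/-- The space `L²(Ω)`, for a subset `Ω` of `ℝ^d`. -/
abbrev L2 {d : ℕ} (Ω : Set (EuclideanSpace ℝ (Fin d))) : Type :=
  Lp ℝ 2 (volume.restrict Ω)

/-- The classical partial derivative `∂_i φ`. -/
def partialDeriv {d : ℕ} (i : Fin d) (φ : EuclideanSpace ℝ (Fin d) → ℝ)
    (x : EuclideanSpace ℝ (Fin d)) : ℝ :=
  fderiv ℝ φ x (EuclideanSpace.single i 1)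

/-- Test functions: smooth, with compact support contained in `Ω`. -/
structure IsTestFunction {d : ℕ} (Ω : Set (EuclideanSpace ℝ (Fin d)))
    (φ : EuclideanSpace ℝ (Fin d) → ℝ) : Prop where
  smooth : ContDiff ℝ (⊤ : ℕ∞) φ
  compact : HasCompactSupport φ
  support : tsupport φ ⊆ Ω

theorem IsTestFunction.memLp {d : ℕ} {Ω : Set (EuclideanSpace ℝ (Fin d))}
    {φ : EuclideanSpace ℝ (Fin d) → ℝ} (h : IsTestFunction Ω φ) :
    MemLp φ 2 (volume.restrict Ω) :=
  (h.smooth.continuous.memLp_of_hasCompactSupport h.compact).restrict Ω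

theorem IsTestFunction.memLp_partialDeriv {d : ℕ} {Ω : Set (EuclideanSpace ℝ (Fin d))}
    {φ : EuclideanSpace ℝ (Fin d) → ℝ} (h : IsTestFunction Ω φ) (i : Fin d) :
    MemLp (partialDeriv i φ) 2 (volume.restrict Ω) := by
  have hc : Continuous (partialDeriv i φ) :=
    (h.smooth.continuous_fderiv (by simp)).clm_apply continuous_const
  have hs : HasCompactSupport (partialDeriv i φ) := h.compact.fderiv_apply ℝ _
  exact (hc.memLp_of_hasCompactSupport hs).restrict Ω

/-- `g` is the weak gradient of `f` in `Ω`. -/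
def IsWeakGrad {d : ℕ} (Ω : Set (EuclideanSpace ℝ (Fin d))) (f : L2 Ω) (g : Fin d → L2 Ω) : Prop :=
  ∀ φ : EuclideanSpace ℝ (Fin d) → ℝ, IsTestFunction Ω φ → ∀ i : Fin d,
    ∫ x in Ω, f x * partialDeriv i φ x = - ∫ x in Ω, g i x * φ x

/-- The Sobolev space `H¹(Ω)`; an element is a function of `L²(Ω)` together with its (unique) weak
gradient, which is in `L²(Ω)^d`. The topology is the one of the graph norm. -/
def H1 {d : ℕ} (Ω : Set (EuclideanSpace ℝ (Fin d))) :
    Submodule ℝ (L2 Ω × (Fin d → L2 Ω)) where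
  carrier := {w | IsWeakGrad Ω w.1 w.2}
  zero_mem' := by
    intro φ _ i
    have h0 : ((0 : L2 Ω) : EuclideanSpace ℝ (Fin d) → ℝ) =ᵐ[volume.restrict Ω] 0 :=
      Lp.coeFn_zero ℝ 2 _
    have h1 : ∫ x in Ω, (0 : L2 Ω) x * partialDeriv i φ x = 0 :=
      integral_eq_zero_of_ae (by
        filter_upwards [h0] with x hx
        rw [hx]
        simp only [Pi.zero_apply, zero_mul])
    have h2 : ∫ x in Ω, (0 : L2 Ω) x * φ x = 0 :=
      integral_eq_zero_of_ae (by
        filter_upwards [h0] with x hx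
        rw [hx]
        simp only [Pi.zero_apply, zero_mul])
    simp only [Prod.fst_zero, Prod.snd_zero, Pi.zero_apply]
    rw [h1, h2, neg_zero]
  add_mem' := by
    intro a b ha hb φ hφ i
    have key : ∀ (f g : L2 Ω) (ψ : EuclideanSpace ℝ (Fin d) → ℝ), MemLp ψ 2 (volume.restrict Ω) →
        ∫ x in Ω, (f + g) x * ψ x = (∫ x in Ω, f x * ψ x) + ∫ x in Ω, g x * ψ x := by
      intro f g ψ hψ
      have h1 : Integrable (fun x => f x * ψ x) (volume.restrict Ω) :=
        (Lp.memLp f).integrable_mul hψ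
      have h2 : Integrable (fun x => g x * ψ x) (volume.restrict Ω) :=
        (Lp.memLp g).integrable_mul hψ
      rw [← integral_add h1 h2]
      refine integral_congr_ae ?_
      filter_upwards [Lp.coeFn_add f g] with x hx
      rw [hx, Pi.add_apply, add_mul]
    have e1 := key a.1 b.1 _ (hφ.memLp_partialDeriv i)
    have e2 := key (a.2 i) (b.2 i) _ hφ.memLp
    have e3 := ha φ hφ i
    have e4 := hb φ hφ i
    simp only [Prod.fst_add, Prod.snd_add, Pi.add_apply]
    rw [e1, e2, e3, e4]
    ring
  smul_mem' := by
    intro c a ha φ hφ i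
    have key : ∀ (f : L2 Ω) (ψ : EuclideanSpace ℝ (Fin d) → ℝ),
        ∫ x in Ω, (c • f) x * ψ x = c * ∫ x in Ω, f x * ψ x := by
      intro f ψ
      rw [← integral_const_mul]
      refine integral_congr_ae ?_
      filter_upwards [Lp.coeFn_smul c f] with x hx
      rw [hx, Pi.smul_apply, smul_eq_mul, mul_assoc]
    have e3 := ha φ hφ i
    simp only [Prod.smul_fst, Prod.smul_snd, Pi.smul_apply]
    rw [key, key, e3]
    ring

/-- The test functions as pairs (function, gradient) in `L²(Ω) × L²(Ω)^d`. -/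
def testGraph {d : ℕ} (Ω : Set (EuclideanSpace ℝ (Fin d))) : Set (L2 Ω × (Fin d → L2 Ω)) :=
  {w | ∃ φ : EuclideanSpace ℝ (Fin d) → ℝ, IsTestFunction Ω φ ∧
    w.1 =ᵐ[volume.restrict Ω] φ ∧ ∀ i, w.2 i =ᵐ[volume.restrict Ω] partialDeriv i φ}

/-- `H¹₀(Ω)`: the closure of the space of test functions in `H¹(Ω)`. -/
def H10 {d : ℕ} (Ω : Set (EuclideanSpace ℝ (Fin d))) :
    Submodule ℝ (L2 Ω × (Fin d → L2 Ω)) :=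
  H1 Ω ⊓ (Submodule.span ℝ (testGraph Ω)).topologicalClosure

/-- The space `H¹₀(Ω)^d` of vector fields. -/
abbrev H10d {d : ℕ} (Ω : Set (EuclideanSpace ℝ (Fin d))) : Type := Fin d → H10 Ω

section Fields

variable {d : ℕ} {Ω : Set (EuclideanSpace ℝ (Fin d))}

/-- The components `w_i` of a vector field, as elements of `L²(Ω)`. -/
def comp (w : H10d Ω) (i : Fin d) : L2 Ω := (w i).1.1

/-- The gradient: `grad w i j = ∂_j w_i`. -/
def grad (w : H10d Ω) (i j : Fin d) : L2 Ω := (w i).1.2 j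

/-- The symmetric gradient `ε(w) = (∇w + (∇w)ᵗ) / 2`. -/
def eps (w : H10d Ω) (i j : Fin d) : L2 Ω := (1 / 2 : ℝ) • (grad w i j + grad w j i)

/-- The divergence. -/
def divg (w : H10d Ω) : L2 Ω := ∑ i, grad w i i

/-- `‖f‖_{L²(Ω)}` for a vector field `f`. -/
def vecNorm (f : Fin d → L2 Ω) : ℝ := √(∑ i, ‖f i‖ ^ 2)

/-- `‖f‖_{L²(Ω)}` for a matrix field `f` (with the Frobenius norm of matrices). -/
def matNorm (f : Fin d → Fin d → L2 Ω) : ℝ := √(∑ i, ∑ j, ‖f i j‖ ^ 2)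

/-- `∫_Ω f · g` for vector fields. -/
def vecInt (f g : Fin d → L2 Ω) : ℝ := ∫ x in Ω, ∑ i, f i x * g i x

/-- `∫_Ω f : g` for matrix fields. -/
def matInt (f g : Fin d → Fin d → L2 Ω) : ℝ := ∫ x in Ω, ∑ i, ∑ j, f i j x * g i j x

end Fields

/-- `P` is a constant of the Poincaré inequality on `H¹₀(Ω)^d`. -/
def IsPoincareConst {d : ℕ} (Ω : Set (EuclideanSpace ℝ (Fin d))) (P : ℝ) : Prop :=
  0 < P ∧ ∀ w : H10d Ω, vecNorm (comp w) ≤ P * matNorm (grad w)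

/-- `K` is a constant of the Korn inequality on `H¹₀(Ω)^d`. -/
def IsKornConst {d : ℕ} (Ω : Set (EuclideanSpace ℝ (Fin d))) (K : ℝ) : Prop :=
  0 < K ∧ ∀ w : H10d Ω, matNorm (grad w) ≤ K * matNorm (eps w)

/-! ### The model and its constants -/

/-- The truncation operator `T_r`. -/
def trunc (r f : ℝ) : ℝ := if |f| ≤ r then f else r * Real.sign f

/-- The parameters of the model; `delta` is the truncation level. -/
structure Params where
  E1 : ℝ
  E2 : ℝ
  lam1 : ℝ
  lam2 : ℝ
  alpha : ℝ
  nu : ℝ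
  rho : ℝ
  delta : ℝ

namespace Params

/-- `F(f) = E₁ (1 + λ₁ f) - d |E₂| (1 + λ₂ f)`. -/
def F (p : Params) (d : ℕ) (f : ℝ) : ℝ :=
  p.E1 * (1 + p.lam1 * f) - d * |p.E2| * (1 + p.lam2 * f)

def gamma1 (p : Params) : ℝ := 1 / (1 + |p.lam1| * p.delta)
def gamma2 (p : Params) : ℝ := 1 / (1 - |p.lam1| * p.delta)
def gamma3 (p : Params) (d : ℕ) : ℝ := p.E1 + d * p.E2
def gamma4 (p : Params) (d : ℕ) : ℝ := p.E1 * p.lam1 + d * p.E2 * p.lam2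
def gamma5 (p : Params) (d : ℕ) : ℝ := 1 / (p.gamma3 d + |p.gamma4 d| * p.delta)
def gamma6 (p : Params) (d : ℕ) : ℝ := 1 / (p.gamma3 d - |p.gamma4 d| * p.delta)
def gamma7 (p : Params) : ℝ := 1 - |p.lam2| * p.delta
def gamma8 (p : Params) : ℝ := 1 + |p.lam2| * p.delta

def D1 (p : Params) (d : ℕ) : ℝ :=
  (p.gamma6 d * p.gamma8) ^ 2 / (p.gamma5 d * p.gamma7) * |p.E2|

def D2 (p : Params) (d : ℕ) : ℝ := 1 + p.D1 d / 2

def D3 (p : Params) (d : ℕ) (h dt : ℝ) : ℝ :=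
  (p.alpha * h) ^ 2 / dt + p.alpha / p.E1 * (p.gamma2 ^ 2 / p.gamma1) * p.D2 d

/-- `P` and `K` are the constants of the Poincaré and Korn inequalities. -/
def D4 (p : Params) (d : ℕ) (h dt P K : ℝ) : ℝ :=
  (p.alpha * P) ^ 2 * (1 + p.E1 * K ^ 2 / (p.alpha * p.gamma1) * p.D3 d h dt)

/-- `d₂(f) = ‖ε(f)‖² + 2 |E₂| γ₅ γ₇ ‖div f‖²`. -/
def d2 (p : Params) {d : ℕ} {Ω : Set (EuclideanSpace ℝ (Fin d))} (f : H10d Ω) : ℝ :=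
  matNorm (eps f) ^ 2 + 2 * |p.E2| * p.gamma5 d * p.gamma7 * ‖divg f‖ ^ 2

/-- `C₁`, for the initial values `u0`, `v0` of the discrete solution; `C` is the stability constant
of the interpolation operator. -/
def C1 (p : Params) {d : ℕ} {Ω : Set (EuclideanSpace ℝ (Fin d))} (C h dt : ℝ) (u0 v0 : H10d Ω) :
    ℝ :=
  vecNorm (comp v0) ^ 2 + 3 * C ^ 2 * p.D3 d h dt / (p.nu * p.rho) * vecNorm (comp u0) ^ 2

def C2 (p : Params) (d : ℕ) (C h dt P K : ℝ) : ℝ :=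
  9 * C ^ 2 * p.D4 d h dt P K / (p.nu * p.rho)

end Params

/-! ### The fully discrete scheme -/

section Scheme

variable {d : ℕ} {Ω : Set (EuclideanSpace ℝ (Fin d))}

/-- The space of discretely divergence-free velocities: the `v ∈ X_h` with `∫_Ω q div v = 0` for
all `q ∈ Q_h`. -/
def discreteDivFree (Xh : Submodule ℝ (H10d Ω)) (Qh : Submodule ℝ (L2 Ω)) : Set (H10d Ω) :=
  {v | v ∈ Xh ∧ ∀ q ∈ Qh, ∫ x in Ω, q x * divg v x = 0}

/-- The (in general nonlinear) map `Pi` into `U_h` is stable in `H¹₀(Ω)^d`, with constant `C`, and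
approximates to first order in `h`. -/
def IsStableInterpolation (Uh : Submodule ℝ (H10d Ω)) (C h : ℝ) (Pi : H10d Ω → H10d Ω) : Prop :=
  ∀ w : H10d Ω, Pi w ∈ Uh ∧ matNorm (grad (Pi w)) ≤ C * matNorm (grad w) ∧
    vecNorm (comp (w - Pi w)) ≤ C * h * matNorm (grad w)

/-- `(u n, v n, pr n)` solves the fully discrete scheme with `N` time steps of length `dt`. -/
structure IsDiscreteSolution (p : Params) (Uh Xh : Submodule ℝ (H10d Ω)) (Qh : Submodule ℝ (L2 Ω))
    (dt : ℝ) (N : ℕ) (u v : ℕ → H10d Ω) (pr : ℕ → L2 Ω) : Prop where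
  u_mem : ∀ n, n ≤ N → u n ∈ Uh
  v_mem : ∀ n, n ≤ N → v n ∈ discreteDivFree Xh Qh
  pr_mem : ∀ n, 1 ≤ n → n ≤ N → pr n ∈ Qh
  displacement : ∀ n, 1 ≤ n → n ≤ N → ∀ z ∈ Uh,
    p.alpha / dt * vecInt (comp (u n - u (n - 1))) (comp z)
      + 1 / p.E1 * (∫ x in Ω, 1 / (1 + p.lam1 * trunc p.delta (divg (u (n - 1)) x))
          * ∑ i, ∑ j, eps (u n) i j x * eps z i j x)
      + |p.E2| / p.E1 * (∫ x in Ω, (1 + p.lam2 * trunc p.delta (divg (u (n - 1)) x))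
          / (1 + p.lam1 * trunc p.delta (divg (u (n - 1)) x))
          * (1 / p.F d (trunc p.delta (divg (u (n - 1)) x)))
          * divg (u n) x * divg z x)
      = p.alpha * vecInt (comp (v n)) (comp z)
  fluid : ∀ n, 1 ≤ n → n ≤ N → ∀ w ∈ Xh,
    p.rho / dt * vecInt (comp (v n - v (n - 1))) (comp w)
      - (∫ x in Ω, pr n x * divg w x)
      + p.nu * matInt (grad (v n)) (grad w)
      + p.alpha * vecInt (comp (v n)) (comp w)
      = p.alpha / dt * vecInt (comp (u n - u (n - 1))) (comp w)

end Scheme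

end

end Poro

/-! The estimate is a discrete energy argument whose coupling terms are closed by a Gronwall
inequality. Truncation confines the argument of the nonlinear coefficients to `[-δ, δ]`, where they
lie between positive constants. Each time step is thus linear elliptic in the new displacement, with
bounds independent of the previous one.

Displacement: testing with `u n` gives coercivity with constant `γ₁/E₁`. Poincaré, Korn and Young
absorb `α ∫ v·u` into half of the strain term, so all displacement quantities are bounded by the
initial ones plus a multiple of `S = ∑ dt ‖v i‖²` (`sum_displacement_energy`). It remains to bound
`S`.

Fluid: testing with `v n` removes the pressure and leaves the coupling `(α/dt) ∫ (u n - u (n-1))·v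
n`. A difference quotient of `u` is not controlled, so `v n` is split into `v n - Pi (v n)`, which
gains a factor `h`, and `Pi (v n)`, an admissible test function in the displacement equation. That
equation trades the difference quotient for `α ∫ v·Pi v` and the elastic form. Everything is then
bounded by `‖∇v‖` times a controlled quantity, and viscosity absorbs `‖∇v‖` (`fluid_energy`).

Inserting the displacement bound into the summed fluid estimate gives an inequality in `v` alone
(`sum_fluid_energy`), to which `discrete_gronwall` applies. The damping term `α ‖v‖²` is kept on the
left throughout: it is what finally bounds `S`. -/

namespace Poro

/-! ### Weighted `L²` pairings -/

section Weighted

variable {α : Type*} {m : MeasurableSpace α} {μ : Measure α}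

theorem integral_mul_eq_inner (f g : Lp ℝ 2 μ) : ∫ x, f x * g x ∂μ = inner ℝ f g := by
  rw [L2.inner_def]
  refine integral_congr_ae (Filter.Eventually.of_forall fun x => ?_)
  simp [mul_comm]

theorem integrable_mul_Lp (f g : Lp ℝ 2 μ) : Integrable (fun x => f x * g x) μ :=
  (Lp.memLp f).integrable_mul (Lp.memLp g)

theorem integrable_weight_mul {c : α → ℝ} {M : ℝ} (hc : AEStronglyMeasurable c μ)
    (hM : ∀ x, |c x| ≤ M) (f g : Lp ℝ 2 μ) : Integrable (fun x => c x * (f x * g x)) μ :=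
  (integrable_mul_Lp f g).bdd_mul hc (Filter.Eventually.of_forall hM)

theorem abs_integral_weight_mul_le {c : α → ℝ} {M : ℝ} (hc : AEStronglyMeasurable c μ)
    (hM : ∀ x, |c x| ≤ M) (f g : Lp ℝ 2 μ) :
    |∫ x, c x * (f x * g x) ∂μ| ≤ M * (‖f‖ * ‖g‖) := by
  -- The weight is moved onto `g`: `c g` is again in `L²`, with norm at most `M ‖g‖`, and
  -- Cauchy–Schwarz finishes.
  have hle : ∀ᵐ x ∂μ, ‖c x * g x‖ ≤ M * ‖g x‖ := Filter.Eventually.of_forall fun x => by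
    rw [norm_mul]
    exact mul_le_mul_of_nonneg_right (hM x) (norm_nonneg _)
  have hmem : MemLp (fun x => c x * g x) 2 μ :=
    (Lp.memLp g).of_le_mul (hc.mul (Lp.aestronglyMeasurable g)) hle
  have hnorm : ‖hmem.toLp‖ ≤ M * ‖g‖ := by
    refine Lp.norm_le_mul_norm_of_ae_le_mul ?_
    filter_upwards [hmem.coeFn_toLp, hle] with x hx hx'
    rwa [hx]
  have heq : ∫ x, c x * (f x * g x) ∂μ = inner ℝ f hmem.toLp := by
    rw [← integral_mul_eq_inner]
    refine integral_congr_ae ?_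
    filter_upwards [hmem.coeFn_toLp] with x hx
    rw [hx]
    ring
  rw [heq]
  calc |inner ℝ f hmem.toLp| ≤ ‖f‖ * ‖hmem.toLp‖ := abs_real_inner_le_norm _ _
    _ ≤ ‖f‖ * (M * ‖g‖) := by gcongr
    _ = M * (‖f‖ * ‖g‖) := by ring

theorem le_integral_weight_mul_self {c : α → ℝ} {l M : ℝ} (hc : AEStronglyMeasurable c μ)
    (hM : ∀ x, |c x| ≤ M) (hl : ∀ x, l ≤ c x) (f : Lp ℝ 2 μ) :
    l * ‖f‖ ^ 2 ≤ ∫ x, c x * (f x * f x) ∂μ := by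
  rw [← real_inner_self_eq_norm_sq, ← integral_mul_eq_inner, ← integral_const_mul]
  exact integral_mono ((integrable_mul_Lp f f).const_mul l) (integrable_weight_mul hc hM f f)
    fun x => mul_le_mul_of_nonneg_right (hl x) (mul_self_nonneg _)

end Weighted

/-! ### Vector and matrix fields; gradient, strain and divergence on `H¹₀` -/

section Fields

variable {d : ℕ} {Ω : Set (EuclideanSpace ℝ (Fin d))}

theorem vecNorm_nonneg (f : Fin d → L2 Ω) : 0 ≤ vecNorm f := Real.sqrt_nonneg _

theorem matNorm_nonneg (f : Fin d → Fin d → L2 Ω) : 0 ≤ matNorm f := Real.sqrt_nonneg _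

theorem vecNorm_sq (f : Fin d → L2 Ω) : vecNorm f ^ 2 = ∑ i, ‖f i‖ ^ 2 :=
  Real.sq_sqrt (Finset.sum_nonneg fun _ _ => sq_nonneg _)

theorem matNorm_sq (f : Fin d → Fin d → L2 Ω) : matNorm f ^ 2 = ∑ i, ∑ j, ‖f i j‖ ^ 2 :=
  Real.sq_sqrt (Finset.sum_nonneg fun _ _ => Finset.sum_nonneg fun _ _ => sq_nonneg _)

theorem vecInt_eq_sum_inner (f g : Fin d → L2 Ω) : vecInt f g = ∑ i, inner ℝ (f i) (g i) := by
  rw [vecInt, integral_finsetSum _ fun i _ => integrable_mul_Lp (f i) (g i)]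
  simp only [integral_mul_eq_inner]

theorem matInt_eq_sum_inner (f g : Fin d → Fin d → L2 Ω) :
    matInt f g = ∑ i, ∑ j, inner ℝ (f i j) (g i j) := by
  rw [matInt, integral_finsetSum _ fun i _ =>
    integrable_finsetSum _ fun j _ => integrable_mul_Lp (f i j) (g i j)]
  refine Finset.sum_congr rfl fun i _ => ?_
  rw [integral_finsetSum _ fun j _ => integrable_mul_Lp (f i j) (g i j)]
  simp only [integral_mul_eq_inner]

theorem matInt_self (f : Fin d → Fin d → L2 Ω) : matInt f f = matNorm f ^ 2 := by
  simp only [matInt_eq_sum_inner, matNorm_sq, real_inner_self_eq_norm_sq]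

theorem abs_vecInt_le (f g : Fin d → L2 Ω) : |vecInt f g| ≤ vecNorm f * vecNorm g := by
  rw [vecInt_eq_sum_inner]
  calc |∑ i, inner ℝ (f i) (g i)| ≤ ∑ i, ‖f i‖ * ‖g i‖ :=
        (Finset.abs_sum_le_sum_abs _ _).trans
          (Finset.sum_le_sum fun i _ => abs_real_inner_le_norm _ _)
    _ ≤ vecNorm f * vecNorm g := Real.sum_mul_le_sqrt_mul_sqrt _ _ _

theorem comp_sub (a b : H10d Ω) : comp (a - b) = comp a - comp b := rfl

theorem vecInt_sub_right (a b f : Fin d → L2 Ω) : vecInt f (a - b) = vecInt f a - vecInt f b := by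
  simp only [vecInt_eq_sum_inner, Pi.sub_apply, inner_sub_right, Finset.sum_sub_distrib]

theorem vecInt_sub_self (a b : Fin d → L2 Ω) :
    2 * vecInt (a - b) a = vecNorm a ^ 2 - vecNorm b ^ 2 + vecNorm (a - b) ^ 2 := by
  simp only [vecInt_eq_sum_inner, vecNorm_sq, Pi.sub_apply, ← Finset.sum_sub_distrib,
    ← Finset.sum_add_distrib, Finset.mul_sum]
  refine Finset.sum_congr rfl fun i _ => ?_
  rw [norm_sub_sq_real, inner_sub_left, real_inner_self_eq_norm_sq, real_inner_comm]
  ring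

theorem vecInt_self (f : Fin d → L2 Ω) : vecInt f f = vecNorm f ^ 2 := by
  simp only [vecInt_eq_sum_inner, vecNorm_sq, real_inner_self_eq_norm_sq]

theorem integral_weight_mat {c : EuclideanSpace ℝ (Fin d) → ℝ} {M : ℝ}
    (hc : AEStronglyMeasurable c (volume.restrict Ω)) (hM : ∀ x, |c x| ≤ M)
    (f g : Fin d → Fin d → L2 Ω) :
    ∫ x in Ω, c x * ∑ i, ∑ j, f i j x * g i j x
      = ∑ i, ∑ j, ∫ x in Ω, c x * (f i j x * g i j x) := by
  simp only [Finset.mul_sum]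
  rw [integral_finsetSum _ fun i _ =>
    integrable_finsetSum _ fun j _ => integrable_weight_mul hc hM (f i j) (g i j)]
  refine Finset.sum_congr rfl fun i _ => ?_
  rw [integral_finsetSum _ fun j _ => integrable_weight_mul hc hM (f i j) (g i j)]

theorem sum_norm_mul_norm_le (f g : Fin d → Fin d → L2 Ω) :
    ∑ i, ∑ j, ‖f i j‖ * ‖g i j‖ ≤ matNorm f * matNorm g := by
  simp only [matNorm, ← Fintype.sum_prod_type']
  exact Real.sum_mul_le_sqrt_mul_sqrt _ (fun k : Fin d × Fin d => ‖f k.1 k.2‖)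
    (fun k => ‖g k.1 k.2‖)

theorem abs_integral_weight_mat_le {c : EuclideanSpace ℝ (Fin d) → ℝ} {M : ℝ}
    (hc : AEStronglyMeasurable c (volume.restrict Ω)) (hM : ∀ x, |c x| ≤ M)
    (f g : Fin d → Fin d → L2 Ω) :
    |∫ x in Ω, c x * ∑ i, ∑ j, f i j x * g i j x| ≤ M * (matNorm f * matNorm g) := by
  have hM0 : 0 ≤ M := (abs_nonneg _).trans (hM 0)
  rw [integral_weight_mat hc hM]
  calc _ ≤ ∑ i, ∑ j, M * (‖f i j‖ * ‖g i j‖) :=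
        (Finset.abs_sum_le_sum_abs _ _).trans (Finset.sum_le_sum fun i _ =>
          (Finset.abs_sum_le_sum_abs _ _).trans (Finset.sum_le_sum fun j _ =>
            abs_integral_weight_mul_le hc hM _ _))
    _ = M * ∑ i, ∑ j, ‖f i j‖ * ‖g i j‖ := by simp only [Finset.mul_sum]
    _ ≤ M * (matNorm f * matNorm g) :=
        mul_le_mul_of_nonneg_left (sum_norm_mul_norm_le f g) hM0

theorem le_integral_weight_mat_self {c : EuclideanSpace ℝ (Fin d) → ℝ} {l M : ℝ}
    (hc : AEStronglyMeasurable c (volume.restrict Ω)) (hM : ∀ x, |c x| ≤ M)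
    (hl : ∀ x, l ≤ c x) (f : Fin d → Fin d → L2 Ω) :
    l * matNorm f ^ 2 ≤ ∫ x in Ω, c x * ∑ i, ∑ j, f i j x * f i j x := by
  rw [integral_weight_mat hc hM, matNorm_sq, Finset.mul_sum]
  refine Finset.sum_le_sum fun i _ => ?_
  rw [Finset.mul_sum]
  exact Finset.sum_le_sum fun j _ => le_integral_weight_mul_self hc hM hl _

theorem IsTestFunction.partialDeriv {φ : EuclideanSpace ℝ (Fin d) → ℝ}
    (h : IsTestFunction Ω φ) (i : Fin d) : IsTestFunction Ω (partialDeriv i φ) where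
  smooth := (h.smooth.fderiv_right (by simp)).clm_apply contDiff_const
  compact := h.compact.fderiv_apply ℝ _
  support := (tsupport_fderiv_apply_subset ℝ _).trans h.support

theorem IsTestFunction.partialDeriv_comm {φ : EuclideanSpace ℝ (Fin d) → ℝ}
    (h : IsTestFunction Ω φ) (i j : Fin d) :
    Poro.partialDeriv i (Poro.partialDeriv j φ) = Poro.partialDeriv j (Poro.partialDeriv i φ) := by
  funext x
  have hsymm : IsSymmSndFDerivAt ℝ φ x :=
    h.smooth.contDiffAt.isSymmSndFDerivAt (by
      rw [minSmoothness_of_isRCLikeNormedField]; exact WithTop.coe_le_coe.2 (le_top : (2 : ℕ∞) ≤ ⊤))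
  have hd : DifferentiableAt ℝ (fderiv ℝ φ) x :=
    ((h.smooth.fderiv_right (m := (⊤ : ℕ∞)) (by simp)).differentiable (by simp)) x
  have key : ∀ k l : Fin d, Poro.partialDeriv k (Poro.partialDeriv l φ) x
      = fderiv ℝ (fderiv ℝ φ) x (EuclideanSpace.single k 1) (EuclideanSpace.single l 1) := by
    intro k l
    unfold Poro.partialDeriv
    rw [fderiv_clm_apply hd (differentiableAt_const _)]
    simp
  rw [key, key]
  exact hsymm _ _

/-- Integration by parts twice, without boundary terms because one factor is a limit of test
functions. For a test function both sides equal minus the integral of `f` against a mixed second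
derivative, and these commute. Both sides are linear and continuous in `g`, so the identity passes
to the closure of the span. -/
theorem inner_weakGrad_comm {f : L2 Ω × (Fin d → L2 Ω)} (hf : f ∈ H1 Ω)
    {g : L2 Ω × (Fin d → L2 Ω)}
    (hg : g ∈ (Submodule.span ℝ (testGraph Ω)).topologicalClosure) (i j : Fin d) :
    inner ℝ (f.2 j) (g.2 i) = inner ℝ (f.2 i) (g.2 j) := by
  let S : Submodule ℝ (L2 Ω × (Fin d → L2 Ω)) :=
    { carrier := {g | inner ℝ (f.2 j) (g.2 i) = inner ℝ (f.2 i) (g.2 j)}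
      zero_mem' := by simp
      add_mem' := fun {a b} ha hb => by
        simp only [Set.mem_ofPred_eq] at ha hb
        simp [inner_add_right, ha, hb]
      smul_mem' := fun c a ha => by
        simp only [Set.mem_ofPred_eq] at ha
        simp [inner_smul_right, ha] }
  have hclosed : IsClosed (S : Set (L2 Ω × (Fin d → L2 Ω))) := by
    change IsClosed {g : L2 Ω × (Fin d → L2 Ω) | inner ℝ (f.2 j) (g.2 i) = inner ℝ (f.2 i) (g.2 j)}
    exact isClosed_eq (by fun_prop) (by fun_prop)
  refine (Submodule.topologicalClosure_minimal _ (Submodule.span_le.2 ?_) hclosed) hg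
  rintro w ⟨φ, hφ, -, hw⟩
  change inner ℝ (f.2 j) (w.2 i) = inner ℝ (f.2 i) (w.2 j)
  have key : ∀ k l : Fin d, inner ℝ (f.2 k) (w.2 l)
      = - ∫ x in Ω, f.1 x * Poro.partialDeriv k (Poro.partialDeriv l φ) x := by
    intro k l
    rw [hf _ (hφ.partialDeriv l) k, neg_neg, ← integral_mul_eq_inner]
    refine integral_congr_ae ?_
    filter_upwards [hw l] with x hx
    rw [hx]
  rw [key, key, hφ.partialDeriv_comm]

theorem inner_grad_comm (w : H10d Ω) (i j : Fin d) :
    inner ℝ (grad w i i) (grad w j j) = inner ℝ (grad w i j) (grad w j i) :=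
  inner_weakGrad_comm (w i).2.1 (w j).2.2 j i

theorem norm_divg_sq (w : H10d Ω) :
    ‖divg w‖ ^ 2 = ∑ i, ∑ j, inner ℝ (grad w i j) (grad w j i) := by
  rw [← real_inner_self_eq_norm_sq, divg, sum_inner]
  refine Finset.sum_congr rfl fun i _ => ?_
  rw [inner_sum]
  exact Finset.sum_congr rfl fun j _ => inner_grad_comm w i j

/-- Expanding the square of the symmetrized gradient, the cross terms `∂_j w_i ∂_i w_j` integrate to
`‖div w‖²` by `norm_divg_sq`. -/
theorem norm_eps_sq (w : H10d Ω) :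
    matNorm (eps w) ^ 2 = (matNorm (grad w) ^ 2 + ‖divg w‖ ^ 2) / 2 := by
  have h2 : ∑ i, ∑ j, ‖grad w j i‖ ^ 2 = matNorm (grad w) ^ 2 := by
    rw [Finset.sum_comm, matNorm_sq]
  have h3 : ∀ i j, ‖eps w i j‖ ^ 2 = 1 / 4 * ‖grad w i j‖ ^ 2 + 1 / 4 * ‖grad w j i‖ ^ 2
      + 1 / 2 * inner ℝ (grad w i j) (grad w j i) := by
    intro i j
    rw [eps, norm_smul, mul_pow, norm_add_sq_real]
    norm_num
    ring
  rw [matNorm_sq (eps w)]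
  simp only [h3, Finset.sum_add_distrib, ← Finset.mul_sum]
  rw [h2, ← norm_divg_sq, ← matNorm_sq]
  ring

/-- After the integration by parts in `norm_divg_sq`, AM-GM on each cross term suffices. The
pointwise bound of the trace would cost a factor `d`. -/
theorem norm_divg_sq_le (w : H10d Ω) : ‖divg w‖ ^ 2 ≤ matNorm (grad w) ^ 2 := by
  have h2 : ∑ i, ∑ j, ‖grad w j i‖ ^ 2 = matNorm (grad w) ^ 2 := by
    rw [Finset.sum_comm, matNorm_sq]
  have h3 : ‖divg w‖ ^ 2 ≤ ∑ i, ∑ j, (‖grad w i j‖ ^ 2 / 2 + ‖grad w j i‖ ^ 2 / 2) := by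
    rw [norm_divg_sq]
    refine Finset.sum_le_sum fun i _ => Finset.sum_le_sum fun j _ => ?_
    nlinarith [real_inner_le_norm (grad w i j) (grad w j i),
      sq_nonneg (‖grad w i j‖ - ‖grad w j i‖)]
  simp only [Finset.sum_add_distrib, ← Finset.sum_div] at h3
  rw [h2, ← matNorm_sq] at h3
  linarith

theorem norm_eps_sq_le (w : H10d Ω) : matNorm (eps w) ^ 2 ≤ matNorm (grad w) ^ 2 := by
  linarith [norm_eps_sq w, norm_divg_sq_le w]

end Fields

/-! ### Truncation and pointwise bounds on the coefficients -/

/-- As a clamp, the truncation is visibly bounded and measurable. -/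
theorem trunc_eq_max_min {r : ℝ} (hr : 0 < r) (f : ℝ) : trunc r f = max (-r) (min r f) := by
  unfold trunc
  split_ifs with h
  · rw [min_eq_right (abs_le.1 h).2, max_eq_right (abs_le.1 h).1]
  · rcases lt_abs.1 (not_le.1 h) with h' | h'
    · rw [Real.sign_of_pos (hr.trans h'), min_eq_left h'.le, max_eq_right (by linarith), mul_one]
    · rw [Real.sign_of_neg (by linarith), min_eq_right (by linarith), max_eq_left (by linarith)]
      ring

theorem abs_trunc_le {r : ℝ} (hr : 0 < r) (f : ℝ) : |trunc r f| ≤ r := by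
  rw [trunc_eq_max_min hr, abs_le]
  exact ⟨le_max_left _ _, max_le (by linarith) (min_le_left _ _)⟩

theorem measurable_trunc {r : ℝ} (hr : 0 < r) : Measurable (trunc r) := by
  rw [funext (trunc_eq_max_min hr)]
  fun_prop

namespace Params

variable {p : Params} {d : ℕ}

/-- The smallness conditions on the parameters of the model. -/
structure Admissible (p : Params) (d : ℕ) : Prop where
  E1_pos : 0 < p.E1
  E2_neg : p.E2 < 0
  alpha_pos : 0 < p.alpha
  nu_pos : 0 < p.nu
  rho_pos : 0 < p.rho
  delta_pos : 0 < p.delta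
  lam1_small : 0 < 1 - |p.lam1| * p.delta
  gamma4_small : 0 < p.gamma3 d - |p.gamma4 d| * p.delta
  lam2_small : 0 < 1 - |p.lam2| * p.delta

/-- The weight of the strain term, as a function of the truncated divergence. -/
noncomputable def strainWeight (p : Params) (t : ℝ) : ℝ := 1 / (1 + p.lam1 * t)

/-- The weight of the divergence term, as a function of the truncated divergence. -/
noncomputable def divWeight (p : Params) (d : ℕ) (t : ℝ) : ℝ :=
  (1 + p.lam2 * t) / (1 + p.lam1 * t) * (1 / p.F d t)

theorem F_eq (hE2 : p.E2 < 0) (t : ℝ) : p.F d t = p.gamma3 d + p.gamma4 d * t := by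
  rw [F, gamma3, gamma4, abs_of_neg hE2]
  ring

theorem mul_mem_Icc {a t r : ℝ} (ht : |t| ≤ r) : -(|a| * r) ≤ a * t ∧ a * t ≤ |a| * r := by
  rw [← abs_le, abs_mul]
  exact mul_le_mul_of_nonneg_left ht (abs_nonneg _)

namespace Admissible

variable (hp : p.Admissible d)
include hp

theorem gamma1_pos : 0 < p.gamma1 := by
  have := mul_nonneg (abs_nonneg p.lam1) hp.delta_pos.le
  exact div_pos one_pos (by linarith)

theorem gamma2_pos : 0 < p.gamma2 := div_pos one_pos hp.lam1_small

theorem gamma5_pos : 0 < p.gamma5 d := by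
  have := mul_nonneg (abs_nonneg (p.gamma4 d)) hp.delta_pos.le
  have := hp.gamma4_small
  exact div_pos one_pos (by linarith)

theorem gamma6_pos : 0 < p.gamma6 d := div_pos one_pos hp.gamma4_small

theorem gamma7_pos : 0 < p.gamma7 := hp.lam2_small

theorem strainWeight_mem {t : ℝ} (ht : |t| ≤ p.delta) :
    p.gamma1 ≤ p.strainWeight t ∧ p.strainWeight t ≤ p.gamma2 := by
  obtain ⟨h1, h2⟩ := mul_mem_Icc (a := p.lam1) ht
  have h := hp.lam1_small
  exact ⟨one_div_le_one_div_of_le (by linarith) (by linarith),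
    one_div_le_one_div_of_le h (by linarith)⟩

theorem one_div_F_mem {t : ℝ} (ht : |t| ≤ p.delta) :
    p.gamma5 d ≤ 1 / p.F d t ∧ 1 / p.F d t ≤ p.gamma6 d := by
  rw [F_eq hp.E2_neg]
  obtain ⟨h1, h2⟩ := mul_mem_Icc (a := p.gamma4 d) ht
  have h := hp.gamma4_small
  exact ⟨one_div_le_one_div_of_le (by linarith) (by linarith),
    one_div_le_one_div_of_le h (by linarith)⟩

/-- The weight is a product of three positive factors, each with its own two-sided bound, so the
bounds multiply. -/
theorem divWeight_mem {t : ℝ} (ht : |t| ≤ p.delta) :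
    p.gamma1 * (p.gamma5 d * p.gamma7) ≤ p.divWeight d t ∧
      p.divWeight d t ≤ p.gamma2 * (p.gamma6 d * p.gamma8) := by
  obtain ⟨h1, h2⟩ := mul_mem_Icc (a := p.lam2) ht
  obtain ⟨h3, h4⟩ := hp.strainWeight_mem ht
  obtain ⟨h5, h6⟩ := hp.one_div_F_mem ht
  have e : p.divWeight d t = p.strainWeight t * ((1 / p.F d t) * (1 + p.lam2 * t)) := by
    unfold divWeight strainWeight
    ring
  have g1 := hp.gamma1_pos
  have g5 := hp.gamma5_pos
  have g7 := hp.gamma7_pos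
  have l7 : p.gamma7 ≤ 1 + p.lam2 * t := by unfold gamma7; linarith
  have l8 : 1 + p.lam2 * t ≤ p.gamma8 := by unfold gamma8; linarith
  have p1 := g1.trans_le h3
  have p5 := g5.trans_le h5
  have p7 := g7.trans_le l7
  have g6 := hp.gamma6_pos
  have g2 := hp.gamma2_pos
  rw [e]
  constructor <;> gcongr

theorem D1_nonneg : 0 ≤ p.D1 d := by
  have := hp.gamma5_pos
  have := hp.gamma7_pos
  unfold D1
  positivity

theorem D2_nonneg : 0 ≤ p.D2 d := by
  have := hp.D1_nonneg
  unfold D2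
  positivity

theorem D3_nonneg {h dt : ℝ} (hdt : 0 < dt) : 0 ≤ p.D3 d h dt := by
  have := hp.D2_nonneg
  have := hp.gamma1_pos
  have := hp.alpha_pos
  have := hp.E1_pos
  unfold D3
  positivity

theorem D4_nonneg {h dt P K : ℝ} (hdt : 0 < dt) : 0 ≤ p.D4 d h dt P K := by
  have := hp.D3_nonneg (h := h) hdt
  have := hp.gamma1_pos
  have := hp.alpha_pos
  have := hp.E1_pos
  unfold D4
  positivity

theorem d2_nonneg {Ω : Set (EuclideanSpace ℝ (Fin d))} (f : H10d Ω) : 0 ≤ p.d2 f := by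
  have := hp.gamma5_pos
  have := hp.gamma7_pos
  unfold d2
  positivity

theorem C1_nonneg {Ω : Set (EuclideanSpace ℝ (Fin d))} {C h dt : ℝ} (hdt : 0 < dt)
    (u0 v0 : H10d Ω) : 0 ≤ p.C1 C h dt u0 v0 := by
  have := hp.D3_nonneg (h := h) hdt
  have := hp.nu_pos
  have := hp.rho_pos
  unfold C1
  positivity

end Admissible

end Params

/-! ### Coercivity and continuity of the elastic form -/

section Forms

variable {d : ℕ} {Ω : Set (EuclideanSpace ℝ (Fin d))} {p : Params}

/-- The elastic form `a(f; w, z)` of the scheme, linearized at the divergence `f`. -/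
noncomputable def elasticForm (p : Params) (f : L2 Ω) (w z : H10d Ω) : ℝ :=
  1 / p.E1 * (∫ x in Ω, p.strainWeight (trunc p.delta (f x)) * ∑ i, ∑ j, eps w i j x * eps z i j x)
    + |p.E2| / p.E1 *
      (∫ x in Ω, p.divWeight d (trunc p.delta (f x)) * (divg w x * divg z x))

theorem aestronglyMeasurable_trunc (hr : 0 < p.delta) {k : ℝ → ℝ} (hk : Measurable k) (f : L2 Ω) :
    AEStronglyMeasurable (fun x => k (trunc p.delta (f x))) (volume.restrict Ω) :=
  ((hk.comp (measurable_trunc hr)).comp_aemeasurable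
    (Lp.aestronglyMeasurable f).aemeasurable).aestronglyMeasurable

theorem measurable_strainWeight (p : Params) : Measurable p.strainWeight := by
  unfold Params.strainWeight
  fun_prop

theorem measurable_divWeight (p : Params) (d : ℕ) : Measurable (p.divWeight d) := by
  unfold Params.divWeight Params.F
  fun_prop

theorem le_elasticForm_self (hp : p.Admissible d) (f : L2 Ω) (w : H10d Ω) :
    p.gamma1 / p.E1 * (matNorm (eps w) ^ 2 + |p.E2| * p.gamma5 d * p.gamma7 * ‖divg w‖ ^ 2)
      ≤ elasticForm p f w w := by
  have ht := fun x => abs_trunc_le hp.delta_pos (f x)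
  have h1 := le_integral_weight_mat_self (M := p.gamma2)
    (aestronglyMeasurable_trunc hp.delta_pos (measurable_strainWeight p) f)
    (fun x => abs_le.2 ⟨by linarith [(hp.strainWeight_mem (ht x)).1, hp.gamma1_pos, hp.gamma2_pos],
      (hp.strainWeight_mem (ht x)).2⟩)
    (fun x => (hp.strainWeight_mem (ht x)).1) (eps w)
  have hl : 0 < p.gamma1 * (p.gamma5 d * p.gamma7) :=
    mul_pos hp.gamma1_pos (mul_pos hp.gamma5_pos hp.gamma7_pos)
  have h2 := le_integral_weight_mul_self (M := p.gamma2 * (p.gamma6 d * p.gamma8))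
    (aestronglyMeasurable_trunc hp.delta_pos (measurable_divWeight p d) f)
    (fun x => abs_le.2 ⟨by linarith [hp.divWeight_mem (ht x)], (hp.divWeight_mem (ht x)).2⟩)
    (fun x => (hp.divWeight_mem (ht x)).1) (divg w)
  have hE := hp.E1_pos
  have k1 : 0 ≤ 1 / p.E1 := by positivity
  have k2 : 0 ≤ |p.E2| / p.E1 := by positivity
  unfold elasticForm
  calc _ = 1 / p.E1 * (p.gamma1 * matNorm (eps w) ^ 2)
        + |p.E2| / p.E1 * (p.gamma1 * (p.gamma5 d * p.gamma7) * ‖divg w‖ ^ 2) := by ring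
    _ ≤ _ := add_le_add (mul_le_mul_of_nonneg_left h1 k1) (mul_le_mul_of_nonneg_left h2 k2)

theorem abs_elasticForm_le (hp : p.Admissible d) (f : L2 Ω) (w z : H10d Ω) :
    |elasticForm p f w z| ≤ p.gamma2 / p.E1 * (matNorm (eps w) * matNorm (eps z)
      + |p.E2| * (p.gamma6 d * p.gamma8) * (‖divg w‖ * ‖divg z‖)) := by
  have ht := fun x => abs_trunc_le hp.delta_pos (f x)
  have h1 := abs_integral_weight_mat_le (M := p.gamma2)
    (aestronglyMeasurable_trunc hp.delta_pos (measurable_strainWeight p) f)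
    (fun x => abs_le.2 ⟨by linarith [(hp.strainWeight_mem (ht x)).1, hp.gamma1_pos, hp.gamma2_pos],
      (hp.strainWeight_mem (ht x)).2⟩) (eps w) (eps z)
  have hl : 0 < p.gamma1 * (p.gamma5 d * p.gamma7) :=
    mul_pos hp.gamma1_pos (mul_pos hp.gamma5_pos hp.gamma7_pos)
  have h2 := abs_integral_weight_mul_le (M := p.gamma2 * (p.gamma6 d * p.gamma8))
    (aestronglyMeasurable_trunc hp.delta_pos (measurable_divWeight p d) f)
    (fun x => abs_le.2 ⟨by linarith [hp.divWeight_mem (ht x)], (hp.divWeight_mem (ht x)).2⟩)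
    (divg w) (divg z)
  have hE := hp.E1_pos
  have k1 : 0 ≤ 1 / p.E1 := by positivity
  have k2 : 0 ≤ |p.E2| / p.E1 := by positivity
  unfold elasticForm
  refine (abs_add_le _ _).trans ?_
  rw [abs_mul, abs_mul, abs_of_nonneg k1, abs_of_nonneg k2]
  refine (add_le_add (mul_le_mul_of_nonneg_left h1 k1) (mul_le_mul_of_nonneg_left h2 k2)).trans
    (le_of_eq ?_)
  ring

/-- A weighted Cauchy–Schwarz inequality. The divergence term of `w` carries the weight `2|E₂|γ₅γ₇`
of `d2`, so that of `z` must carry the complementary weight, which is `D₁/2`. Bounding strain and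
divergence of `z` by its gradient then turns `1 + D₁/2` into `D₂`. -/
theorem elasticForm_sq_le (hp : p.Admissible d) (f : L2 Ω) (w z : H10d Ω) :
    elasticForm p f w z ^ 2
      ≤ (p.gamma2 / p.E1) ^ 2 * p.D2 d * p.d2 w * matNorm (grad z) ^ 2 := by
  have h := abs_elasticForm_le hp f w z
  have he := norm_eps_sq_le z
  have hs := norm_divg_sq_le z
  have g5 := hp.gamma5_pos
  have g7 := hp.gamma7_pos
  have hd2 := hp.d2_nonneg w
  have hD1 := hp.D1_nonneg
  set e := matNorm (eps w)
  set s := ‖divg w‖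
  set X := matNorm (eps z)
  set Y := ‖divg z‖
  set q := p.gamma6 d * p.gamma8 with hq
  set r := p.gamma5 d * p.gamma7 with hr
  have hr0 : 0 < r := mul_pos g5 g7
  have hD : p.D1 d * r = q ^ 2 * |p.E2| := by
    rw [Params.D1, ← hq, ← hr]
    field_simp
  have hd : p.d2 w = e ^ 2 + 2 * |p.E2| * r * s ^ 2 := by
    rw [Params.d2, hr]
    ring
  have hcs : (e * X + |p.E2| * q * (s * Y)) ^ 2 ≤ p.d2 w * (X ^ 2 + p.D1 d / 2 * Y ^ 2) := by
    have e1 : p.d2 w * (X ^ 2 + p.D1 d / 2 * Y ^ 2) = e ^ 2 * X ^ 2 + e ^ 2 * Y ^ 2 * (p.D1 d / 2)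
        + 2 * |p.E2| * r * s ^ 2 * X ^ 2 + |p.E2| * s ^ 2 * Y ^ 2 * (p.D1 d * r) := by
      rw [hd]; ring
    -- The cross term: after multiplication by `r`, the difference of the two sides is a perfect
    -- square, because `D₁ r = q² |E₂|`.
    have e3 : 2 * (e * X) * (|p.E2| * q * (s * Y)) ≤
        e ^ 2 * Y ^ 2 * (p.D1 d / 2) + 2 * |p.E2| * r * s ^ 2 * X ^ 2 := by
      rw [← mul_le_mul_iff_left₀ hr0]
      have e4 : (e ^ 2 * Y ^ 2 * (p.D1 d / 2) + 2 * |p.E2| * r * s ^ 2 * X ^ 2) * r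
          - 2 * (e * X) * (|p.E2| * q * (s * Y)) * r
          = |p.E2| / 2 * (e * Y * q - 2 * r * s * X) ^ 2
            + e ^ 2 * Y ^ 2 / 2 * (p.D1 d * r - q ^ 2 * |p.E2|) := by ring
      rw [hD, sub_self, mul_zero, add_zero] at e4
      have : 0 ≤ |p.E2| / 2 * (e * Y * q - 2 * r * s * X) ^ 2 := by positivity
      linarith
    rw [e1, hD]
    calc _ = e ^ 2 * X ^ 2 + 2 * (e * X) * (|p.E2| * q * (s * Y))
          + |p.E2| * s ^ 2 * Y ^ 2 * (q ^ 2 * |p.E2|) := by ring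
      _ ≤ _ := by linarith
  have hXY : X ^ 2 + p.D1 d / 2 * Y ^ 2 ≤ p.D2 d * matNorm (grad z) ^ 2 := by
    rw [Params.D2, add_mul, one_mul]
    gcongr
  calc elasticForm p f w z ^ 2 = |elasticForm p f w z| ^ 2 := (sq_abs _).symm
    _ ≤ (p.gamma2 / p.E1 * (e * X + |p.E2| * q * (s * Y))) ^ 2 := by gcongr
    _ = (p.gamma2 / p.E1) ^ 2 * (e * X + |p.E2| * q * (s * Y)) ^ 2 := by ring
    _ ≤ (p.gamma2 / p.E1) ^ 2 * (p.d2 w * (p.D2 d * matNorm (grad z) ^ 2)) :=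
        mul_le_mul_of_nonneg_left
          (hcs.trans (mul_le_mul_of_nonneg_left hXY hd2)) (sq_nonneg _)
    _ = _ := by ring

end Forms

/-! ### Discrete Gronwall inequality and summation over the time steps -/

section Gronwall

theorem one_le_one_sub_mul_exp {x : ℝ} (h0 : 0 ≤ x) (h1 : 2 * x ≤ 1) :
    1 ≤ (1 - x) * Real.exp (3 * x) := by
  calc (1 : ℝ) ≤ (1 - x) * (3 * x + 1) := by nlinarith
    _ ≤ _ := mul_le_mul_of_nonneg_left (Real.add_one_le_exp _) (by linarith)

/-- With `Z_n` the right-hand side of the hypothesis, `y_n ≤ Z_n` gives the implicit recursion `(1 -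
G dt) Z_n ≤ Z_{n-1}`. Since `G dt ≤ 1/2`, dividing costs at most `exp (3 G dt)` per step. The
conclusion bounds `Z_n` rather than `y_n`, so it also controls any further terms that `Z_n`
dominates. -/
theorem discrete_gronwall {A G dt : ℝ} (hA : 0 ≤ A) (hG : 0 ≤ G) (hdt : 0 ≤ dt)
    (hstep : 2 * (G * dt) ≤ 1) {y : ℕ → ℝ} {N : ℕ}
    (hy : ∀ n, 1 ≤ n → n ≤ N → y n ≤ A + G * ∑ i ∈ Finset.Icc 1 n, dt * y i)
    {n : ℕ} (hn : n ≤ N) :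
    A + G * ∑ i ∈ Finset.Icc 1 n, dt * y i ≤ A * Real.exp (3 * G * (n * dt)) := by
  induction n with
  | zero => simp
  | succ k ih =>
    have ih := ih (by omega)
    have h := hy (k + 1) (by omega) hn
    rw [Finset.sum_Icc_succ_top (by omega)] at h ⊢
    have hx : 0 ≤ G * dt := mul_nonneg hG hdt
    set S := ∑ i ∈ Finset.Icc 1 k, dt * y i
    set Z := A + G * (S + dt * y (k + 1)) with hZ
    have h1 : (1 - G * dt) * Z ≤ A * Real.exp (3 * G * (k * dt)) := by
      have : G * dt * y (k + 1) ≤ G * dt * Z := mul_le_mul_of_nonneg_left h hx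
      refine le_trans ?_ ih
      linarith
    have hexp : Real.exp (3 * G * ((k + 1 : ℕ) * dt))
        = Real.exp (3 * G * (k * dt)) * Real.exp (3 * (G * dt)) := by
      rw [← Real.exp_add]
      push_cast
      ring_nf
    have h2 := one_le_one_sub_mul_exp hx hstep
    -- No sign is assumed on `y`, so `Z` may be negative; the bound is then trivial.
    rcases le_total Z 0 with hZ0 | hZ0
    · exact hZ0.trans (by positivity)
    calc Z = 1 * Z := (one_mul Z).symm
      _ ≤ (1 - G * dt) * Real.exp (3 * (G * dt)) * Z := mul_le_mul_of_nonneg_right h2 hZ0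
      _ = (1 - G * dt) * Z * Real.exp (3 * (G * dt)) := by ring
      _ ≤ A * Real.exp (3 * G * (k * dt)) * Real.exp (3 * (G * dt)) :=
          mul_le_mul_of_nonneg_right h1 (Real.exp_pos _).le
      _ = _ := by rw [hexp]; ring

theorem le_sum_Icc_of_step {N : ℕ} {a b c : ℕ → ℝ}
    (hstep : ∀ i, 1 ≤ i → i ≤ N → a i - a (i - 1) + b i ≤ c i) {n : ℕ} (hn : n ≤ N) :
    a n + ∑ i ∈ Finset.Icc 1 n, b i ≤ a 0 + ∑ i ∈ Finset.Icc 1 n, c i := by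
  induction n with
  | zero => simp
  | succ k ih =>
    have ih := ih (by omega)
    have h := hstep (k + 1) (by omega) hn
    rw [Nat.add_sub_cancel] at h
    rw [Finset.sum_Icc_succ_top (by omega), Finset.sum_Icc_succ_top (by omega)]
    linarith

end Gronwall

/-- The share `ν/6` lets three such terms together use only half of the viscous dissipation. -/
theorem young_six {nu g c A : ℝ} (hnu : 0 < nu) :
    c * g * A ≤ nu / 6 * g ^ 2 + 3 * c ^ 2 / (2 * nu) * A ^ 2 := by
  have h : nu / 6 * g ^ 2 + 3 * c ^ 2 / (2 * nu) * A ^ 2 - c * g * A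
      = (nu * g - 3 * c * A) ^ 2 / (6 * nu) := by
    field_simp
    ring
  have : 0 ≤ (nu * g - 3 * c * A) ^ 2 / (6 * nu) := by positivity
  linarith

/-! ### Energy estimates for the scheme -/

section Energy

variable {d : ℕ} {Ω : Set (EuclideanSpace ℝ (Fin d))} {p : Params}
  {Uh Xh : Submodule ℝ (H10d Ω)} {Qh : Submodule ℝ (L2 Ω)} {dt : ℝ} {N : ℕ}
  {u v : ℕ → H10d Ω} {pr : ℕ → L2 Ω}

theorem IsDiscreteSolution.displacement_eq (hsol : IsDiscreteSolution p Uh Xh Qh dt N u v pr)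
    {n : ℕ} (h1 : 1 ≤ n) (hN : n ≤ N) {z : H10d Ω} (hz : z ∈ Uh) :
    p.alpha / dt * vecInt (comp (u n) - comp (u (n - 1))) (comp z)
      + elasticForm p (divg (u (n - 1))) (u n) z = p.alpha * vecInt (comp (v n)) (comp z) := by
  rw [← hsol.displacement n h1 hN z hz, ← comp_sub, elasticForm, ← add_assoc]
  simp only [Params.strainWeight, Params.divWeight, mul_assoc]

/-- The pressure term vanishes because `v n` is discretely divergence-free and `pr n` lies in `Qh`.
-/
theorem IsDiscreteSolution.fluid_self (hsol : IsDiscreteSolution p Uh Xh Qh dt N u v pr)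
    {n : ℕ} (h1 : 1 ≤ n) (hN : n ≤ N) :
    p.rho / dt * vecInt (comp (v n) - comp (v (n - 1))) (comp (v n))
      + p.nu * matNorm (grad (v n)) ^ 2 + p.alpha * vecNorm (comp (v n)) ^ 2
      = p.alpha / dt * vecInt (comp (u n) - comp (u (n - 1))) (comp (v n)) := by
  obtain ⟨hX, hdiv⟩ := hsol.v_mem n hN
  have h := hsol.fluid n h1 hN (v n) hX
  rw [hdiv _ (hsol.pr_mem n h1 hN), sub_zero, matInt_self, vecInt_self] at h
  exact h

theorem IsDiscreteSolution.displacement_energy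
    (hsol : IsDiscreteSolution p Uh Xh Qh dt N u v pr) (hp : p.Admissible d) (hdt : 0 < dt)
    {P K : ℝ} (hP : IsPoincareConst Ω P) (hK : IsKornConst Ω K)
    {n : ℕ} (h1 : 1 ≤ n) (hN : n ≤ N) :
    vecNorm (comp (u n)) ^ 2 - vecNorm (comp (u (n - 1))) ^ 2
      + (vecNorm (comp (u n) - comp (u (n - 1))) ^ 2
        + p.gamma1 / (p.alpha * p.E1) * (dt * p.d2 (u n)))
      ≤ p.alpha * (P * K) ^ 2 * p.E1 / p.gamma1 * (dt * vecNorm (comp (v n)) ^ 2) := by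
  have heq := hsol.displacement_eq h1 hN (hsol.u_mem n hN)
  have h2 := vecInt_sub_self (comp (u n)) (comp (u (n - 1)))
  have hle := le_elasticForm_self hp (divg (u (n - 1))) (u n)
  have hq : vecInt (comp (v n)) (comp (u n)) ≤
      vecNorm (comp (v n)) * (P * (K * matNorm (eps (u n)))) :=
    (le_abs_self _).trans <| (abs_vecInt_le _ _).trans <|
      mul_le_mul_of_nonneg_left ((hP.2 _).trans
        (mul_le_mul_of_nonneg_left (hK.2 _) hP.1.le)) (vecNorm_nonneg _)
  have ha := hp.alpha_pos
  have hE := hp.E1_pos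
  have hg := hp.gamma1_pos
  rw [Params.d2]
  set V := vecNorm (comp (v n))
  set e := matNorm (eps (u n))
  set R := |p.E2| * p.gamma5 d * p.gamma7 * ‖divg (u n)‖ ^ 2 with hR
  set x := vecInt (comp (u n) - comp (u (n - 1))) (comp (u n))
  -- Only half of the strain term is spent. What remains, `e²/2 + R`, is half of `d2`, which
  -- explains the factor 2 in the divergence part of `d2`.
  have young : p.alpha * (V * (P * (K * e))) ≤
      p.gamma1 / p.E1 * e ^ 2 / 2 + (p.alpha * P * K) ^ 2 * p.E1 / p.gamma1 * V ^ 2 / 2 := by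
    have : p.gamma1 / p.E1 * e ^ 2 / 2 + (p.alpha * P * K) ^ 2 * p.E1 / p.gamma1 * V ^ 2 / 2
        - p.alpha * (V * (P * (K * e)))
        = (p.gamma1 * e - p.alpha * P * K * p.E1 * V) ^ 2 / (2 * p.E1 * p.gamma1) := by
      field_simp
      ring
    have : 0 ≤ (p.gamma1 * e - p.alpha * P * K * p.E1 * V) ^ 2 / (2 * p.E1 * p.gamma1) := by
      positivity
    linarith
  have main : p.alpha / dt * x + p.gamma1 / p.E1 * (e ^ 2 / 2 + R)
      ≤ (p.alpha * P * K) ^ 2 * p.E1 / p.gamma1 * V ^ 2 / 2 := by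
    have := mul_le_mul_of_nonneg_left hq ha.le
    linarith
  have hc : 0 ≤ 2 * dt / p.alpha := by positivity
  have := mul_le_mul_of_nonneg_left main hc
  have e1 : 2 * dt / p.alpha * (p.alpha / dt * x + p.gamma1 / p.E1 * (e ^ 2 / 2 + R))
      = 2 * x + p.gamma1 / (p.alpha * p.E1) * (dt * (e ^ 2 + 2 * R)) := by
    field_simp
  have e2 : 2 * dt / p.alpha * ((p.alpha * P * K) ^ 2 * p.E1 / p.gamma1 * V ^ 2 / 2)
      = p.alpha * (P * K) ^ 2 * p.E1 / p.gamma1 * (dt * V ^ 2) := by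
    field_simp
  rw [e1, e2, h2, hR] at this
  refine le_trans (le_of_eq ?_) this
  ring

theorem IsDiscreteSolution.fluid_energy
    (hsol : IsDiscreteSolution p Uh Xh Qh dt N u v pr) (hp : p.Admissible d) (hdt : 0 < dt)
    {P : ℝ} (hP : IsPoincareConst Ω P) {C h : ℝ} (hC : 0 < C)
    {Pi : H10d Ω → H10d Ω} (hPi : IsStableInterpolation Uh C h Pi)
    {n : ℕ} (h1 : 1 ≤ n) (hN : n ≤ N) :
    vecNorm (comp (v n)) ^ 2 - vecNorm (comp (v (n - 1))) ^ 2
      + 2 * p.alpha / p.rho * (dt * vecNorm (comp (v n)) ^ 2)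
      ≤ 3 * C ^ 2 / (p.nu * p.rho) *
        ((p.alpha * h) ^ 2 / dt * vecNorm (comp (u n) - comp (u (n - 1))) ^ 2
          + (p.alpha * P) ^ 2 * (dt * vecNorm (comp (v n)) ^ 2)
          + (p.gamma2 / p.E1) ^ 2 * p.D2 d * (dt * p.d2 (u n))) := by
  obtain ⟨hU, hstab, happ⟩ := hPi (v n)
  have heq := hsol.fluid_self h1 hN
  have hdis := hsol.displacement_eq h1 hN hU
  have h2 := vecInt_sub_self (comp (v n)) (comp (v (n - 1)))
  have hform := elasticForm_sq_le hp (divg (u (n - 1))) (u n) (Pi (v n))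
  rw [comp_sub] at happ
  have ha := hp.alpha_pos
  have hnu := hp.nu_pos
  have hrho := hp.rho_pos
  have hd2 := hp.d2_nonneg (u n)
  have hD2 := hp.D2_nonneg
  -- The coupling term is split along `v n = (v n - Pi (v n)) + Pi (v n)`; `hdis` then eliminates
  -- the difference quotient tested with `Pi (v n)`.
  have hsplit := vecInt_sub_right (comp (v n)) (comp (Pi (v n))) (comp (u n) - comp (u (n - 1)))
  have hA := (le_abs_self _).trans (abs_vecInt_le (comp (u n) - comp (u (n - 1)))
    (comp (v n) - comp (Pi (v n))))
  have hB := (le_abs_self _).trans (abs_vecInt_le (comp (v n)) (comp (Pi (v n))))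
  have hw0 := vecNorm_nonneg (comp (u n) - comp (u (n - 1)))
  have hV0 := vecNorm_nonneg (comp (v n))
  have hz0 := matNorm_nonneg (grad (Pi (v n)))
  have hg0 := matNorm_nonneg (grad (v n))
  have hPz := hP.2 (Pi (v n))
  set w := vecNorm (comp (u n) - comp (u (n - 1)))
  set V := vecNorm (comp (v n))
  set g := matNorm (grad (v n))
  set gz := matNorm (grad (Pi (v n)))
  set J := elasticForm p (divg (u (n - 1))) (u n) (Pi (v n))
  set Z := (p.gamma2 / p.E1) ^ 2 * p.D2 d * p.d2 (u n) with hZ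
  have hZ0 : 0 ≤ Z := by positivity
  have bA : p.alpha / dt * vecInt (comp (u n) - comp (u (n - 1))) (comp (v n) - comp (Pi (v n)))
      ≤ C * g * (p.alpha * h / dt * w) := by
    calc _ ≤ p.alpha / dt * (w * (C * h * g)) :=
          mul_le_mul_of_nonneg_left (hA.trans (mul_le_mul_of_nonneg_left happ hw0)) (by positivity)
      _ = _ := by ring
  have bB : p.alpha * vecInt (comp (v n)) (comp (Pi (v n))) ≤ C * g * (p.alpha * P * V) := by
    calc _ ≤ p.alpha * (V * (P * (C * g))) := by
          refine mul_le_mul_of_nonneg_left (hB.trans (mul_le_mul_of_nonneg_left ?_ hV0)) ha.le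
          exact hPz.trans (mul_le_mul_of_nonneg_left hstab hP.1.le)
      _ = _ := by ring
  have bJ : -J ≤ C * g * √Z := by
    have hJ : J ^ 2 ≤ (C * g * √Z) ^ 2 := by
      rw [mul_pow, Real.sq_sqrt hZ0, mul_comm _ Z]
      exact hform.trans (mul_le_mul_of_nonneg_left (by gcongr) hZ0)
    exact (neg_le_abs J).trans (abs_le_of_sq_le_sq hJ (by positivity))
  have yA := young_six (g := g) (c := C) (A := p.alpha * h / dt * w) hnu
  have yB := young_six (g := g) (c := C) (A := p.alpha * P * V) hnu
  have yJ := young_six (g := g) (c := C) (A := √Z) hnu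
  rw [Real.sq_sqrt hZ0] at yJ
  set x := vecInt (comp (v n) - comp (v (n - 1))) (comp (v n))
  have hg2 : 0 ≤ p.nu * g ^ 2 / 2 := by positivity
  rw [hsplit] at bA
  -- The three Young inequalities use `ν g²/2`; the other half of the dissipation is dropped.
  have main : p.rho / dt * x + p.alpha * V ^ 2 ≤ 3 * C ^ 2 / (2 * p.nu) *
      ((p.alpha * h / dt * w) ^ 2 + (p.alpha * P * V) ^ 2 + Z) := by
    linarith
  have hc : 0 ≤ 2 * dt / p.rho := by positivity
  have := mul_le_mul_of_nonneg_left main hc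
  have e1 : 2 * dt / p.rho * (p.rho / dt * x + p.alpha * V ^ 2)
      = 2 * x + 2 * p.alpha / p.rho * (dt * V ^ 2) - vecNorm (comp (v n) - comp (v (n - 1))) ^ 2
        + vecNorm (comp (v n) - comp (v (n - 1))) ^ 2 := by
    field_simp
    ring
  have e2 : 2 * dt / p.rho * (3 * C ^ 2 / (2 * p.nu) *
      ((p.alpha * h / dt * w) ^ 2 + (p.alpha * P * V) ^ 2 + Z))
      = 3 * C ^ 2 / (p.nu * p.rho) * ((p.alpha * h) ^ 2 / dt * w ^ 2
          + (p.alpha * P) ^ 2 * (dt * V ^ 2)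
          + (p.gamma2 / p.E1) ^ 2 * p.D2 d * (dt * p.d2 (u n))) := by
    rw [hZ]
    field_simp
  rw [e1, e2, h2] at this
  -- The squared velocity increment produced by backward Euler is discarded.
  linarith [sq_nonneg (vecNorm (comp (v n) - comp (v (n - 1))))]

theorem IsDiscreteSolution.sum_displacement_energy
    (hsol : IsDiscreteSolution p Uh Xh Qh dt N u v pr) (hp : p.Admissible d) (hdt : 0 < dt)
    {P K : ℝ} (hP : IsPoincareConst Ω P) (hK : IsKornConst Ω K) {n : ℕ} (hN : n ≤ N) :
    vecNorm (comp (u n)) ^ 2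
      + ∑ i ∈ Finset.Icc 1 n, vecNorm (comp (u i) - comp (u (i - 1))) ^ 2
      + p.gamma1 / (p.alpha * p.E1) * ∑ i ∈ Finset.Icc 1 n, dt * p.d2 (u i)
      ≤ vecNorm (comp (u 0)) ^ 2 + p.alpha * (P * K) ^ 2 * p.E1 / p.gamma1 *
        ∑ i ∈ Finset.Icc 1 n, dt * vecNorm (comp (v i)) ^ 2 := by
  have := le_sum_Icc_of_step (fun i h1 hN => hsol.displacement_energy hp hdt hP hK h1 hN) hN
    (a := fun i => vecNorm (comp (u i)) ^ 2)
    (b := fun i => vecNorm (comp (u i) - comp (u (i - 1))) ^ 2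
        + p.gamma1 / (p.alpha * p.E1) * (dt * p.d2 (u i)))
    (c := fun i => p.alpha * (P * K) ^ 2 * p.E1 / p.gamma1 * (dt * vecNorm (comp (v i)) ^ 2))
  simpa only [Finset.sum_add_distrib, ← Finset.mul_sum, ← add_assoc] using this

theorem IsDiscreteSolution.sum_fluid_energy
    (hsol : IsDiscreteSolution p Uh Xh Qh dt N u v pr) (hp : p.Admissible d) (hdt : 0 < dt)
    {P K : ℝ} (hP : IsPoincareConst Ω P) (hK : IsKornConst Ω K) {C h : ℝ} (hC : 0 < C)
    {Pi : H10d Ω → H10d Ω} (hPi : IsStableInterpolation Uh C h Pi) {n : ℕ} (hN : n ≤ N) :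
    vecNorm (comp (v n)) ^ 2
      + 2 * p.alpha / p.rho * ∑ i ∈ Finset.Icc 1 n, dt * vecNorm (comp (v i)) ^ 2
      ≤ p.C1 C h dt (u 0) (v 0) + 3 * C ^ 2 * p.D4 d h dt P K / (p.nu * p.rho) *
        ∑ i ∈ Finset.Icc 1 n, dt * vecNorm (comp (v i)) ^ 2 := by
  have hv := le_sum_Icc_of_step (fun i h1 hN => hsol.fluid_energy hp hdt hP hC hPi h1 hN) hN
    (a := fun i => vecNorm (comp (v i)) ^ 2)
    (b := fun i => 2 * p.alpha / p.rho * (dt * vecNorm (comp (v i)) ^ 2))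
    (c := fun i => 3 * C ^ 2 / (p.nu * p.rho) *
        ((p.alpha * h) ^ 2 / dt * vecNorm (comp (u i) - comp (u (i - 1))) ^ 2
          + (p.alpha * P) ^ 2 * (dt * vecNorm (comp (v i)) ^ 2)
          + (p.gamma2 / p.E1) ^ 2 * p.D2 d * (dt * p.d2 (u i))))
  simp only [← Finset.mul_sum, Finset.sum_add_distrib] at hv
  -- The simplification also pulled `dt` out of the sums; it is put back to match the displacement
  -- estimate.
  rw [Finset.mul_sum _ _ dt, Finset.mul_sum _ _ dt] at hv
  have hu := hsol.sum_displacement_energy hp hdt hP hK hN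
  have ha := hp.alpha_pos
  have hE := hp.E1_pos
  have hg := hp.gamma1_pos
  have hnu := hp.nu_pos
  have hrho := hp.rho_pos
  have hD2 := hp.D2_nonneg
  have hW : 0 ≤ ∑ i ∈ Finset.Icc 1 n, vecNorm (comp (u i) - comp (u (i - 1))) ^ 2 :=
    Finset.sum_nonneg fun _ _ => sq_nonneg _
  have hD : 0 ≤ ∑ i ∈ Finset.Icc 1 n, dt * p.d2 (u i) :=
    Finset.sum_nonneg fun i _ => mul_nonneg hdt.le (hp.d2_nonneg (u i))
  have hun : 0 ≤ vecNorm (comp (u n)) ^ 2 := sq_nonneg _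
  set W := ∑ i ∈ Finset.Icc 1 n, vecNorm (comp (u i) - comp (u (i - 1))) ^ 2
  set D := ∑ i ∈ Finset.Icc 1 n, dt * p.d2 (u i)
  set S := ∑ i ∈ Finset.Icc 1 n, dt * vecNorm (comp (v i)) ^ 2
  clear_value W D S
  set B := vecNorm (comp (u 0)) ^ 2 + p.alpha * (P * K) ^ 2 * p.E1 / p.gamma1 * S with hB
  have hcD : 0 ≤ p.gamma1 / (p.alpha * p.E1) * D := mul_nonneg (by positivity) hD
  -- The displacement estimate controls `D` with weight `γ₁/(αE₁)`. Factoring out this weight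
  -- produces the second summand of `D₃`; the first comes from the increments `W`, each bounded by
  -- `B`.
  have e1 : (p.gamma2 / p.E1) ^ 2 * p.D2 d * D
      = p.alpha / p.E1 * (p.gamma2 ^ 2 / p.gamma1) * p.D2 d
        * (p.gamma1 / (p.alpha * p.E1) * D) := by
    field_simp
  have h1 : (p.alpha * h) ^ 2 / dt * W ≤ (p.alpha * h) ^ 2 / dt * B :=
    mul_le_mul_of_nonneg_left (by linarith) (by positivity)
  have h2 : (p.gamma2 / p.E1) ^ 2 * p.D2 d * D
      ≤ p.alpha / p.E1 * (p.gamma2 ^ 2 / p.gamma1) * p.D2 d * B := by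
    rw [e1]
    exact mul_le_mul_of_nonneg_left (by linarith) (by positivity)
  have h3 : (p.alpha * h) ^ 2 / dt * W + (p.alpha * P) ^ 2 * S
      + (p.gamma2 / p.E1) ^ 2 * p.D2 d * D ≤ p.D3 d h dt * B + (p.alpha * P) ^ 2 * S := by
    rw [Params.D3, add_mul]
    linarith
  have hc : 0 ≤ 3 * C ^ 2 / (p.nu * p.rho) := by positivity
  refine hv.trans ((add_le_add le_rfl (mul_le_mul_of_nonneg_left h3 hc)).trans (le_of_eq ?_))
  -- In `D₃ B + (αP)² S`, the initial displacement goes into `C₁` and the coefficient of `S` is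
  -- exactly `D₄`.
  rw [Params.C1, Params.D4, hB]
  field_simp
  ring

end Energy

end Poro

/-! ### The stability estimate -/

theorem corollary3p4 {d : ℕ} (hd : d = 2 ∨ d = 3)
    -- the domain
    (Ω : Set (EuclideanSpace ℝ (Fin d))) (hΩ : IsOpen Ω) (hΩb : Bornology.IsBounded Ω)
    (P K : ℝ) (hP : Poro.IsPoincareConst Ω P) (hK : Poro.IsKornConst Ω K)
    -- the parameters of the model
    (p : Poro.Params) (hE1 : 0 < p.E1) (hE2 : p.E2 < 0) (hE : 0 < p.E1 - d * |p.E2|)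
    (halpha : 0 < p.alpha) (hnu : 0 < p.nu) (hrho : 0 < p.rho) (hdelta : 0 < p.delta)
    -- the parameters `λ₁`, `λ₂` are small
    (hsmall1 : 0 < 1 - |p.lam1| * p.delta)
    (hsmall2 : 0 < p.gamma3 d - |p.gamma4 d| * p.delta)
    (hsmall3 : 0 < 1 - |p.lam2| * p.delta)
    -- the discrete spaces
    (Uh Xh : Submodule ℝ (Poro.H10d Ω)) [FiniteDimensional ℝ Uh] [FiniteDimensional ℝ Xh]
    (Qh : Submodule ℝ (Poro.L2 Ω)) [FiniteDimensional ℝ Qh]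
    (hQh : ∀ q ∈ Qh, ∫ x in Ω, q x = 0)
    (h C : ℝ) (hh : 0 < h) (hC : 0 < C)
    (Pi : Poro.H10d Ω → Poro.H10d Ω) (hPi : Poro.IsStableInterpolation Uh C h Pi)
    -- the time steps
    (T : ℝ) (hT : 0 < T) (N : ℕ) (hN : 0 < N) (dt : ℝ) (hdt : dt = T / N)
    (hstep : 6 * (C ^ 2 * p.D4 d h dt P K / (p.nu * p.rho)) * dt ≤ 1)
    -- the discrete solution
    (u v : ℕ → Poro.H10d Ω) (pr : ℕ → Poro.L2 Ω)
    (hsol : Poro.IsDiscreteSolution p Uh Xh Qh dt N u v pr)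
    (n : ℕ) (hn1 : 1 ≤ n) (hnN : n ≤ N) :
    Poro.vecNorm (Poro.comp (u n)) ^ 2
      + ∑ i ∈ Finset.Icc 1 n, Poro.vecNorm (Poro.comp (u i - u (i - 1))) ^ 2
      + p.gamma1 / (p.alpha * p.E1) * ∑ i ∈ Finset.Icc 1 n, dt * p.d2 (u i)
      ≤ Poro.vecNorm (Poro.comp (u 0)) ^ 2
        + p.E1 / p.gamma1 * ((P * K) ^ 2 / 2) * p.rho * p.C1 C h dt (u 0) (v 0)
          * Real.exp (p.C2 d C h dt P K * (n * dt)) := by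
  have hp : p.Admissible d :=
    ⟨hE1, hE2, halpha, hnu, hrho, hdelta, hsmall1, hsmall2, hsmall3⟩
  have hdt0 : 0 < dt := by
    rw [hdt]
    exact div_pos hT (Nat.cast_pos.2 hN)
  have hu := hsol.sum_displacement_energy hp hdt0 hP hK hnN
  simp only [Poro.comp_sub]
  refine hu.trans (add_le_add le_rfl ?_)
  have hg := hp.gamma1_pos
  have hD4 := hp.D4_nonneg (h := h) (P := P) (K := K) hdt0
  -- With this `G`, the step restriction reads `2 G dt ≤ 1` and `C₂ = 3 G`, as the Gronwall lemma
  -- requires.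
  set G := 3 * C ^ 2 * p.D4 d h dt P K / (p.nu * p.rho) with hG
  have hG0 : 0 ≤ G := by positivity
  have hGstep : 2 * (G * dt) ≤ 1 := by
    refine le_trans (le_of_eq ?_) hstep
    rw [hG]
    ring
  have hv := fun k (hk : k ≤ N) => hsol.sum_fluid_energy hp hdt0 hP hK hC hPi hk
  have hS : ∀ k, 0 ≤ 2 * p.alpha / p.rho *
      ∑ i ∈ Finset.Icc 1 k, dt * Poro.vecNorm (Poro.comp (v i)) ^ 2 := fun k =>
    mul_nonneg (by positivity) (Finset.sum_nonneg fun _ _ => by positivity)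
  have hgr := Poro.discrete_gronwall (hp.C1_nonneg (C := C) (h := h) hdt0 (u 0) (v 0)) hG0
    hdt0.le hGstep (y := fun i => Poro.vecNorm (Poro.comp (v i)) ^ 2)
    (fun k _ hk => by linarith [hv k hk, hS k]) hnN
  have hC2 : p.C2 d C h dt P K = 3 * G := by
    rw [Poro.Params.C2, hG]
    ring
  have hvn := hv n hnN
  rw [hC2]
  set S := ∑ i ∈ Finset.Icc 1 n, dt * Poro.vecNorm (Poro.comp (v i)) ^ 2
  -- Gronwall bounds the whole right-hand side of the fluid estimate, hence also the damping sum on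
  -- its left. The factor `2α/ρ` accounts for `ρ/2` in the final constant.
  have hfin : 2 * p.alpha / p.rho * S
      ≤ p.C1 C h dt (u 0) (v 0) * Real.exp (3 * G * (n * dt)) := by
    linarith [sq_nonneg (Poro.vecNorm (Poro.comp (v n)))]
  have hc : 0 ≤ p.E1 / p.gamma1 * ((P * K) ^ 2 / 2) * p.rho := by positivity
  calc p.alpha * (P * K) ^ 2 * p.E1 / p.gamma1 * S
      = p.E1 / p.gamma1 * ((P * K) ^ 2 / 2) * p.rho * (2 * p.alpha / p.rho * S) := by
        field_simp
    _ ≤ _ := mul_le_mul_of_nonneg_left hfin hc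
    _ = _ := by ring
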